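/- Let $q$ be a prime power, let $n\ge 2$ be an integer, and let $\mathbb F_{q^2}$ be the field with $q^2$ elements, equipped with its unique non-identity involution $\bar x=x^q$. Let $\mathcal{HGL}_n(\mathbb F_{q^2})$ be the graph whose vertices are the invertible $n\times n$ hermitian matrices over $\mathbb F_{q^2}$ (those invertible $A$ with $\overline{A}^{\top}=A$), two vertices $A,B$ being adjacent if and only if $\operatorname{rank}(A-B)=1$. A graph is a core if all its endomorphisms are automorphisms, and a subgraph $\Gamma'$ of a graph $\Gamma$ is a core of $\Gamma$ if $\Gamma'$ is a core and there exists a graph homomorphism $\Gamma\to\Gamma'$ (every finite graph has a core, unique up to isomorphism). Then every core $\Gamma'$ of $\mathcal{HGL}_n(\mathbb F_{q^2})$ has chromatic number $\chi(\Gamma')>q$. In particular, the core of $\mathcal{HGL}_n(\mathbb F_{q^2})$ is not a complete graph. -/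

import Mathlib

/-- The graph `HGL_n(F)` of invertible `n × n` hermitian matrices over a field `F` with involution
`star`: two such matrices are adjacent when their difference has rank one. -/
def HGL (n : ℕ) (F : Type*) [Field F] [StarRing F] :
    SimpleGraph {A : Matrix (Fin n) (Fin n) F // A.IsHermitian ∧ IsUnit A} where
  Adj A B := (A.1 - B.1).rank = 1
  symm := ⟨fun A B h => by
    have hneg : Matrix.mulVecLin (B.1 - A.1) = -Matrix.mulVecLin (A.1 - B.1) := by
      ext1 i; simp
    rw [Matrix.rank, hneg, LinearMap.range_neg]; exact h⟩
  loopless := ⟨fun A h => by simp at h⟩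

/-- A graph is a core if all its endomorphisms are automorphisms. -/
def IsGraphCore {V : Type*} (G : SimpleGraph V) : Prop :=
  ∀ f : G →g G, ∃ e : G ≃g G, ∀ v, e v = f v

/-- A subgraph `H` of `G` is a core of `G` if it is a core and there is a homomorphism `G → H`. -/
def IsCoreOf {V : Type*} {G : SimpleGraph V} (H : G.Subgraph) : Prop :=
  IsGraphCore H.coe ∧ Nonempty (G →g H.coe)

/-- Every finite graph has a core. -/
theorem exists_isCoreOf {V : Type*} [Finite V] (G : SimpleGraph V) :
    ∃ H : G.Subgraph, IsCoreOf H := by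
  classical
  have hne : {H : G.Subgraph | Nonempty (G →g H.coe)}.Nonempty :=
    ⟨⊤, ⟨⟨fun v => ⟨v, trivial⟩, fun h => h⟩⟩⟩
  obtain ⟨H, ⟨g⟩, hmin⟩ := exists_minimalFor_of_wellFoundedLT
    (fun H : G.Subgraph => Nonempty (G →g H.coe)) (fun H => H.verts.ncard) hne
  refine ⟨H, fun f => ?_, ⟨g⟩⟩
  have hsurj : Function.Surjective f := by
    let S : Set V := Set.range fun v => (f v : V)
    have hSH : S ⊆ H.verts := by
      rintro _ ⟨v, rfl⟩
      exact (f v).2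
    have hle := hmin (j := H.induce S)
      ⟨⟨fun v => ⟨(f (g v) : V), ⟨g v, rfl⟩⟩,
        fun {a b} h => ⟨⟨g a, rfl⟩, ⟨g b, rfl⟩, f.map_adj (g.map_adj h)⟩⟩⟩
      (Set.ncard_le_ncard hSH (Set.toFinite _))
    have hEq : S = H.verts := Set.eq_of_subset_of_ncard_le hSH hle (Set.toFinite _)
    intro w
    have hw : (w : V) ∈ S := hEq.symm.subset w.2
    obtain ⟨v, hv⟩ := hw
    exact ⟨v, Subtype.ext hv⟩
  have hbij : Function.Bijective f := ⟨Finite.injective_iff_surjective.2 hsurj, hsurj⟩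
  let e : Equiv.Perm H.verts := Equiv.ofBijective f hbij
  have hpow : ∀ (k : ℕ) a b, H.coe.Adj a b → H.coe.Adj ((e ^ k) a) ((e ^ k) b) := by
    intro k
    induction k with
    | zero => exact fun a b h => h
    | succ k ih =>
      intro a b h
      rw [pow_succ]
      exact ih _ _ (f.map_adj h)
  refine ⟨⟨e, fun {a b} => ⟨fun h => ?_, fun h => f.map_adj h⟩⟩, fun v => rfl⟩
  have h1 : e ^ (orderOf e - 1) * e = 1 := by
    rw [pow_sub_one_mul (orderOf_pos e).ne', pow_orderOf_eq_one]
  have h2 := hpow (orderOf e - 1) _ _ h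
  have h3 : ∀ x, (e ^ (orderOf e - 1)) (e x) = x := fun x => by
    rw [← Equiv.Perm.mul_apply, h1, Equiv.Perm.one_apply]
  rwa [h3, h3] at h2

/-! Write `q` for the number of fixed elements of the involution, so that the field has `q²`
elements. The graph on 2 × 2 matrices maps to the graph on n × n matrices, hence to the core, so it
suffices that the former has no `q`-colouring.

It has at least `q(q²+1)(q-1)` vertices (`le_card_invertible_hermitian`), so a `q`-colouring has a
class of at least `(q²+1)(q-1)` matrices. Distinct members of a class have invertible difference,
and this persists when 0 is added. Let `S` be such a set of size `(q²+1)(q-1)+1` and fix `B ∈ S`.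
Count pairs `(A, u)` with `A ∈ S`, `A ≠ B` and `u ≠ 0` isotropic for `A - B`: each `A` has at least
`(q+1)(q²-1)` such `u`, each `u` at most `q²-1` such `A`. The two bounds give the same total, so
each `u` has exactly `q²-1`. For `u = (1,0)` the fibres of `A ↦ A 0 0` on `S` all have size `q²`,
yet `q²` does not divide `|S| = q³-q²+q`.

A complete core would be a clique, and cliques have at most `q` vertices (`card_clique_HGL_le`). -/

open Matrix Finset

/-! ### Trace and norm fibres of the involution -/

section FieldCounting

variable {F : Type*} [Field F] [Fintype F] [DecidableEq F] [StarRing F]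

variable (F) in
/-- The elements fixed by the involution. -/
def fixedElems : Finset F := univ.filter fun x => star x = x

theorem mem_fixedElems {x : F} : x ∈ fixedElems F ↔ star x = x := by simp [fixedElems]

theorem zero_mem_fixedElems : (0 : F) ∈ fixedElems F := by simp [mem_fixedElems]

theorem card_fixedElems_sq (hstar : ∃ x : F, star x ≠ x) :
    Fintype.card F = (fixedElems F).card ^ 2 := by
  obtain ⟨d, hd⟩ := hstar
  have hd' : star d - d ≠ 0 := sub_ne_zero.2 hd
  have hd'' : d - star d ≠ 0 := sub_ne_zero.2 (Ne.symm hd)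
  rw [sq, ← card_product, ← card_univ]
  symm
  -- `1, d` is a basis over the fixed field; applying `star` to `x = a + b d` and subtracting gives
  -- `b`.
  refine card_bij' (fun p _ => p.1 + p.2 * d)
    (fun x _ => (x - (star x - x) / (star d - d) * d, (star x - x) / (star d - d))) ?_ ?_ ?_ ?_
  · simp
  · intro x _
    simp only [mem_product, mem_fixedElems, star_sub, star_mul', star_div₀, star_star]
    constructor <;> field_simp <;> ring
  · rintro ⟨a, b⟩ h
    simp only [mem_product, mem_fixedElems] at h
    ext <;> simp only [star_add, star_mul', h.1, h.2] <;> field_simp <;> ring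
  · intro x _
    simp

theorem card_skew (hstar : ∃ x : F, star x ≠ x) :
    (univ.filter fun x : F => x + star x = 0).card = (fixedElems F).card := by
  obtain ⟨d, hd⟩ := hstar
  have hd' : star d - d ≠ 0 := sub_ne_zero.2 hd
  have hd'' : d - star d ≠ 0 := sub_ne_zero.2 (Ne.symm hd)
  refine card_bij' (fun x _ => x / (star d - d)) (fun x _ => x * (star d - d)) ?_ ?_ ?_ ?_
  · intro x hx
    have hx' : star x = -x := by
      simp only [mem_filter, mem_univ, true_and] at hx
      linear_combination hx
    simp only [mem_fixedElems, star_sub, star_div₀, star_star, hx']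
    field_simp
    ring
  · intro x hx
    rw [mem_fixedElems] at hx
    simp only [mem_filter, mem_univ, true_and, star_sub, star_mul', star_star, hx]
    ring
  · intro x _
    field_simp
  · intro x _
    field_simp

/-- Each fibre is empty or a translate of the skew elements, so has at most `q` elements; the `q`
fibres cover all `q²` elements, so every bound is attained. -/
theorem card_trace_fiber (hstar : ∃ x : F, star x ≠ x) {c : F} (hc : star c = c) :
    (univ.filter fun x : F => x + star x = c).card = (fixedElems F).card := by
  have hle : ∀ c ∈ fixedElems F,
      (univ.filter fun x : F => x + star x = c).card ≤ (fixedElems F).card := by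
    intro c _
    rcases (univ.filter fun x : F => x + star x = c).eq_empty_or_nonempty with h | ⟨y, hy⟩
    · simp [h]
    · rw [← card_skew hstar]
      simp only [mem_filter, mem_univ, true_and] at hy
      refine card_le_card_of_injOn (fun x => x - y) ?_ (fun a _ b _ h => sub_left_injective h)
      intro x hx
      simp only [coe_filter, mem_univ, true_and, Set.mem_ofPred_eq, star_sub] at hx ⊢
      linear_combination hx - hy
  have hsum : ∑ c ∈ fixedElems F, (univ.filter fun x : F => x + star x = c).card
      = ∑ c ∈ fixedElems F, (fixedElems F).card := by
    rw [← card_eq_sum_card_fiberwise (f := fun x : F => x + star x), card_univ,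
      card_fixedElems_sq hstar, sum_const, smul_eq_mul, sq]
    intro x _
    simp [mem_fixedElems, add_comm]
  exact (sum_eq_sum_iff_of_le hle).1 hsum c (mem_fixedElems.2 hc)

theorem card_fixedElems_erase :
    ((fixedElems F).erase 0).card = (fixedElems F).card - 1 :=
  card_erase_of_mem zero_mem_fixedElems

theorem two_le_card_fixedElems : 2 ≤ (fixedElems F).card := by
  have : ({0, 1} : Finset F) ⊆ fixedElems F := by
    intro x
    simp only [mem_insert, mem_singleton]
    rintro (rfl | rfl) <;> simp [mem_fixedElems]
  simpa using card_le_card this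

/-- The map `y ↦ y / star y` sends the `q²-1` nonzero elements to norm-one elements, and each fibre
is a coset of the `q-1` nonzero fixed elements. -/
theorem card_norm_one (hstar : ∃ x : F, star x ≠ x) :
    (univ.filter fun x : F => x * star x = 1).card = (fixedElems F).card + 1 := by
  obtain ⟨d, hd⟩ := id hstar
  have hd' : star d - d ≠ 0 := sub_ne_zero.2 hd
  have hfib : ∀ x ∈ univ.filter (fun x : F => x * star x = 1),
      ((univ.erase (0 : F)).filter fun y => y / star y = x).card = (fixedElems F).card - 1 := by
    intro x hx
    simp only [mem_filter, mem_univ, true_and] at hx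
    -- Hilbert 90: `1 + x` works unless it vanishes, and then any nonzero skew element does.
    obtain ⟨y, hy0, hy⟩ : ∃ y : F, y ≠ 0 ∧ y = x * star y := by
      by_cases h : x = -1
      · exact ⟨star d - d, hd', by simp [h]⟩
      · refine ⟨1 + x, fun h0 => h (by linear_combination h0), ?_⟩
        simp only [star_add, star_one]
        linear_combination -hx
    have hsy : star y ≠ 0 := by simpa using hy0
    rw [← card_fixedElems_erase]
    refine card_bij' (fun z _ => z / y) (fun z _ => z * y) ?_ ?_ ?_ ?_
    · intro z hz
      simp only [mem_filter, mem_erase, mem_univ, and_true] at hz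
      have hsz : star z ≠ 0 := by simpa using hz.1
      have h2 := hz.2
      rw [div_eq_iff hsz] at h2
      simp only [mem_erase, mem_fixedElems, star_div₀]
      refine ⟨div_ne_zero hz.1 hy0, ?_⟩
      rw [div_eq_div_iff hsy hy0]
      linear_combination star z * hy - star y * h2
    · intro z hz
      simp only [mem_erase, mem_fixedElems] at hz
      simp only [mem_filter, mem_erase, mem_univ, and_true, star_mul', hz.2]
      refine ⟨mul_ne_zero hz.1 hy0, ?_⟩
      rw [div_eq_iff (mul_ne_zero hz.1 hsy)]
      linear_combination z * hy
    · intro z _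
      field_simp
    · intro z _
      field_simp
  have h := card_eq_sum_card_fiberwise (s := univ.erase (0 : F))
    (t := univ.filter fun x : F => x * star x = 1) (f := fun y : F => y / star y) (by
      intro y hy
      have hy0 : y ≠ 0 := by simpa using hy
      have hsy : star y ≠ 0 := by simpa using hy0
      simp only [coe_filter, mem_univ, true_and, Set.mem_ofPred_eq, star_div₀, star_star]
      field_simp)
  rw [sum_congr rfl hfib, sum_const, smul_eq_mul, card_erase_of_mem (mem_univ _), card_univ,
    card_fixedElems_sq hstar] at h
  have h2 := two_le_card_fixedElems (F := F)
  obtain ⟨k, hk⟩ := Nat.exists_eq_add_of_le h2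
  rw [hk] at h ⊢
  have e1 : (2 + k) ^ 2 - 1 = (2 + k + 1) * (k + 1) := by
    have : (2 + k) ^ 2 = (2 + k + 1) * (k + 1) + 1 := by ring
    omega
  have e2 : 2 + k - 1 = k + 1 := by omega
  rw [e1, e2] at h
  exact (Nat.eq_of_mul_eq_mul_right (Nat.succ_pos k) h).symm

/-- As for the trace: fibres are empty or cosets of the norm-one group, and the total forces
equality. -/
theorem card_norm_fiber (hstar : ∃ x : F, star x ≠ x) {c : F} (hc : star c = c) (hc0 : c ≠ 0) :
    (univ.filter fun x : F => x * star x = c).card = (fixedElems F).card + 1 := by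
  have hle : ∀ c ∈ (fixedElems F).erase 0,
      ((univ.erase (0 : F)).filter fun x : F => x * star x = c).card
        ≤ (fixedElems F).card + 1 := by
    intro c _
    rcases ((univ.erase (0 : F)).filter fun x : F => x * star x = c).eq_empty_or_nonempty
      with h | ⟨y, hy⟩
    · simp [h]
    · rw [← card_norm_one hstar]
      simp only [mem_filter, mem_erase, mem_univ, and_true] at hy
      have hsy : star y ≠ 0 := by simpa using hy.1
      refine card_le_card_of_injOn (fun x => x / y) ?_ (fun a _ b _ h => ?_)
      · intro x hx
        simp only [coe_filter, mem_erase, mem_univ, and_true, true_and, Set.mem_ofPred_eq,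
          star_div₀] at hx ⊢
        rw [div_mul_div_comm, hx.2, hy.2, div_self]
        rw [← hy.2]
        exact mul_ne_zero hy.1 hsy
      · exact (div_left_inj' hy.1).1 h
  have hsum : ∑ c ∈ (fixedElems F).erase 0,
      ((univ.erase (0 : F)).filter fun x : F => x * star x = c).card
      = ∑ c ∈ (fixedElems F).erase 0, ((fixedElems F).card + 1) := by
    rw [← card_eq_sum_card_fiberwise (f := fun x : F => x * star x),
      card_erase_of_mem (mem_univ _), card_univ,
      card_fixedElems_sq hstar, sum_const, smul_eq_mul, card_fixedElems_erase]
    · have := two_le_card_fixedElems (F := F)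
      obtain ⟨k, hk⟩ := Nat.exists_eq_add_of_le this
      rw [hk, show (2 + k) ^ 2 = (k + 1) * (2 + k + 1) + 1 by ring,
        show 2 + k - 1 = k + 1 by omega]
      rfl
    · intro x hx
      have hx0 : x ≠ 0 := by simpa using hx
      simp [mem_fixedElems, mul_comm, hx0]
  rw [← (sum_eq_sum_iff_of_le hle).1 hsum c (mem_erase.2 ⟨hc0, mem_fixedElems.2 hc⟩)]
  congr 1
  ext x
  simp only [mem_filter, mem_erase, mem_univ, true_and, and_true]
  refine ⟨fun h => ⟨?_, h⟩, fun h => h.2⟩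
  rintro rfl
  exact hc0 (by simpa using h.symm)

/-- Number of affine solutions of a nondegenerate hermitian equation in two variables. -/
theorem card_hermitian_conic (hstar : ∃ x : F, star x ≠ x) {a b c : F} (ha : star a = a)
    (hc : star c = c) (hdet : a * c ≠ b * star b) :
    (univ.filter fun r : F => a * (r * star r) + star r * b + star b * r + c = 0).card =
      (fixedElems F).card + if a = 0 then 0 else 1 := by
  split_ifs with h
  · subst h
    have hb : b ≠ 0 := by
      rintro rfl
      simp at hdet
    have hsb : star b ≠ 0 := by simpa using hb
    rw [add_zero, ← card_trace_fiber hstar (c := -c) (by simp [hc])]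
    refine card_bij' (fun r _ => star b * r) (fun z _ => z / star b) ?_ ?_ ?_ ?_
    · intro r hr
      simp only [mem_filter, mem_univ, true_and, star_mul', star_star] at hr ⊢
      linear_combination hr
    · intro z hz
      simp only [mem_filter, mem_univ, true_and, star_div₀, star_star] at hz ⊢
      rw [div_mul_cancel₀ _ hb, mul_div_cancel₀ _ hsb]
      linear_combination hz
    · intro r _
      field_simp
    · intro r _
      field_simp
  -- Completing the square: `a r + b` has norm `b * star b - a * c`.
  · rw [← card_norm_fiber hstar (c := b * star b - a * c) (by simp [ha, hc, mul_comm])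
      (sub_ne_zero.2 hdet.symm)]
    refine card_bij' (fun r _ => a * r + b) (fun z _ => (z - b) / a) ?_ ?_ ?_ ?_
    · intro r hr
      simp only [mem_filter, mem_univ, true_and, star_add, star_mul', ha] at hr ⊢
      linear_combination a * hr
    · intro z hz
      simp only [mem_filter, mem_univ, true_and, star_sub, star_div₀, ha] at hz ⊢
      field_simp
      linear_combination hz
    · intro r _
      field_simp
      ring
    · intro r _
      field_simp
      ring

end FieldCounting

/-! ### Isotropic vectors and the double count -/

section HermitianForms

theorem star_dotProduct_mulVec_fin_two {F : Type*} [Field F] [StarRing F]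
    (v : Matrix (Fin 2) (Fin 2) F) (s t : F) :
    star ![s, t] ⬝ᵥ (v *ᵥ ![s, t]) =
      star s * (v 0 0 * s + v 0 1 * t) + star t * (v 1 0 * s + v 1 1 * t) := by
  simp [dotProduct, mulVec, Fin.sum_univ_two]

theorem card_dotProduct_eq_zero_le {F : Type*} [Field F] [Fintype F]
    [DecidableEq F] {w : Fin 2 → F} (hw : w ≠ 0) :
    (univ.filter fun z : Fin 2 → F => w ⬝ᵥ z = 0).card ≤ Fintype.card F := by
  rw [← card_univ]
  by_cases h : w 0 = 0
  · have h1 : w 1 ≠ 0 := fun h1 => hw (by ext i; fin_cases i <;> simp [h, h1])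
    refine card_le_card_of_injOn (fun z => z 0) (by simp) ?_
    intro z hz z' hz' e
    simp [dotProduct, Fin.sum_univ_two, h, h1] at hz hz'
    ext i
    fin_cases i
    · exact e
    · simp [hz, hz']
  · refine card_le_card_of_injOn (fun z => z 1) (by simp) ?_
    intro z hz z' hz' e
    simp only [dotProduct, Fin.sum_univ_two, coe_filter, mem_univ, true_and,
      Set.mem_ofPred_eq] at hz hz' e
    ext i
    fin_cases i
    · refine mul_left_cancel₀ h ?_
      simp only [Fin.zero_eta]
      linear_combination hz - hz' - w 1 * e
    · exact e

variable {F : Type*} [Field F] [Fintype F] [DecidableEq F] [StarRing F]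

/-- A nondegenerate hermitian form in two variables has at least `(q + 1)(q² - 1)` nonzero
isotropic vectors. -/
theorem le_card_isotropic (hstar : ∃ x : F, star x ≠ x) {v : Matrix (Fin 2) (Fin 2) F}
    (hv : v.IsHermitian) (hdet : v.det ≠ 0) :
    ((fixedElems F).card + 1) * ((fixedElems F).card ^ 2 - 1) ≤
      (univ.filter fun u : Fin 2 → F => u ≠ 0 ∧ star u ⬝ᵥ (v *ᵥ u) = 0).card := by
  have h00 : star (v 0 0) = v 0 0 := hv.apply 0 0
  have h11 : star (v 1 1) = v 1 1 := hv.apply 1 1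
  have h10 : v 1 0 = star (v 0 1) := (hv.apply 1 0).symm
  have hd : v 0 0 * v 1 1 ≠ v 0 1 * star (v 0 1) := by
    rw [det_fin_two, h10] at hdet
    exact sub_ne_zero.1 hdet
  have hS := card_hermitian_conic hstar h00 h11 hd
  set S := univ.filter fun r : F =>
    v 0 0 * (r * star r) + star r * v 0 1 + star (v 0 1) * r + v 1 1 = 0 with hSdef
  set E : Finset F := univ.erase 0 with hE
  have hEcard : E.card = (fixedElems F).card ^ 2 - 1 := by
    rw [hE, card_erase_of_mem (mem_univ _), card_univ, card_fixedElems_sq hstar]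
  -- `T₁` scales the affine solutions `(r, 1)`; `T₂` is the point at infinity, isotropic exactly
  -- when `v 0 0 = 0`, which is when the affine count is one short of `q + 1`.
  let T₁ : Finset (Fin 2 → F) := (S ×ˢ E).image fun p => ![p.2 * p.1, p.2]
  let T₂ : Finset (Fin 2 → F) := if v 0 0 = 0 then E.image (fun s => ![s, 0]) else ∅
  have hT₁ : T₁.card = S.card * E.card := by
    rw [← card_product]
    refine card_image_of_injOn ?_
    rintro ⟨r, t⟩ h ⟨r', t'⟩ h' e
    simp only [coe_product, Set.mem_prod, mem_coe, hE, mem_erase, mem_univ, and_true] at h h'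
    have e0 := congrFun e 0
    have e1 := congrFun e 1
    simp only [cons_val_zero, cons_val_one] at e0 e1
    subst e1
    simpa [h.2] using e0
  have hT₂ : T₂.card = (if v 0 0 = 0 then 1 else 0) * E.card := by
    simp only [T₂]
    split_ifs
    · rw [one_mul]
      refine card_image_of_injective _ fun a b e => ?_
      simpa using congrFun e 0
    · simp
  have hdisj : Disjoint T₁ T₂ := by
    rw [disjoint_left]
    intro u h1 h2
    simp only [T₂] at h2
    split_ifs at h2
    · obtain ⟨⟨r, t⟩, hrt, rfl⟩ := mem_image.1 h1
      obtain ⟨s, -, e⟩ := mem_image.1 h2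
      have e1 := congrFun e 1
      have ht : t = 0 := by simpa using e1.symm
      simp [hE, ht] at hrt
    · simp at h2
  have hsub : T₁ ∪ T₂ ⊆ univ.filter fun u : Fin 2 → F => u ≠ 0 ∧ star u ⬝ᵥ (v *ᵥ u) = 0 := by
    intro u hu
    simp only [mem_filter, mem_univ, true_and]
    rcases mem_union.1 hu with h | h
    · obtain ⟨⟨r, t⟩, hrt, rfl⟩ := mem_image.1 h
      simp only [hE, hSdef, mem_product, mem_filter, mem_univ, true_and, mem_erase,
        and_true] at hrt
      refine ⟨fun e => hrt.2 (by simpa using congrFun e 1), ?_⟩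
      rw [star_dotProduct_mulVec_fin_two, h10, star_mul']
      linear_combination t * star t * hrt.1
    · simp only [T₂] at h
      split_ifs at h with h0
      · obtain ⟨s, hs, rfl⟩ := mem_image.1 h
        refine ⟨fun e => (mem_erase.1 hs).1 (by simpa using congrFun e 0), ?_⟩
        rw [star_dotProduct_mulVec_fin_two, h0]
        simp
      · simp at h
  refine le_trans (le_of_eq ?_) (card_le_card hsub)
  rw [card_union_of_disjoint hdisj, hT₁, hT₂, hS, ← hEcard, ← add_mul]
  split_ifs <;> rfl

/-- In a set of matrices whose pairwise differences are invertible, at most `q²` elements differ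
from a given matrix by a form for which a given nonzero vector is isotropic. -/
theorem card_isotropic_difference_le {S : Finset (Matrix (Fin 2) (Fin 2) F)}
    (hS : ∀ A ∈ S, ∀ B ∈ S, A ≠ B → (A - B).det ≠ 0) (B : Matrix (Fin 2) (Fin 2) F)
    {u : Fin 2 → F} (hu : u ≠ 0) :
    (S.filter fun A => star u ⬝ᵥ ((A - B) *ᵥ u) = 0).card ≤ Fintype.card F := by
  refine le_trans ?_ (card_dotProduct_eq_zero_le (w := star u) (by simpa using hu))
  -- Invertible differences make this map injective, and its values lie on the line `star u ⬝ᵥ z =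
  -- 0`.
  refine card_le_card_of_injOn (fun A => (A - B) *ᵥ u) ?_ ?_
  · intro A hA
    exact mem_coe.2 (mem_filter.2 ⟨mem_univ _, (mem_filter.1 hA).2⟩)
  · intro A hA A' hA' e
    by_contra hne
    refine hS A (mem_filter.1 hA).1 A' (mem_filter.1 hA').1 hne ?_
    refine exists_mulVec_eq_zero_iff.1 ⟨u, hu, ?_⟩
    have e' : (A - B) *ᵥ u = (A' - B) *ᵥ u := e
    rw [show A - A' = (A - B) - (A' - B) by abel, sub_mulVec, e', sub_self]

theorem card_isotropic_difference_eq (hstar : ∃ x : F, star x ≠ x)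
    {S : Finset (Matrix (Fin 2) (Fin 2) F)} (hherm : ∀ A ∈ S, A.IsHermitian)
    (hS : ∀ A ∈ S, ∀ B ∈ S, A ≠ B → (A - B).det ≠ 0)
    (hcard : S.card = ((fixedElems F).card ^ 2 + 1) * ((fixedElems F).card - 1) + 1)
    {B : Matrix (Fin 2) (Fin 2) F} (hB : B ∈ S) {u : Fin 2 → F} (hu : u ≠ 0) :
    (S.filter fun A => star u ⬝ᵥ ((A - B) *ᵥ u) = 0).card = (fixedElems F).card ^ 2 := by
  set k := (fixedElems F).card with hk
  have hk2 : 2 ≤ k := two_le_card_fixedElems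
  have hF : Fintype.card F = k ^ 2 := card_fixedElems_sq hstar
  set P : Matrix (Fin 2) (Fin 2) F → (Fin 2 → F) → Prop :=
    fun A u => star u ⬝ᵥ ((A - B) *ᵥ u) = 0 with hP
  -- `B` itself satisfies `P B u` trivially, hence the shift by one.
  have herase : ∀ u : Fin 2 → F, (S.filter fun A => P A u).card =
      ((S.erase B).filter fun A => P A u).card + 1 := by
    intro u
    rw [filter_erase, card_erase_add_one]
    simp [hP, hB]
  set U : Finset (Fin 2 → F) := univ.erase 0 with hU
  have hUcard : U.card = k ^ 4 - 1 := by
    rw [hU, card_erase_of_mem (mem_univ _), card_univ]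
    simp [hF, ← pow_mul]
  have hle : ∀ u ∈ U, ((S.erase B).filter fun A => P A u).card ≤ k ^ 2 - 1 := by
    intro u hu
    have h1 := card_isotropic_difference_le hS B (mem_erase.1 hu).1
    have h2 := herase u
    rw [hF] at h1
    change (S.filter fun A => P A u).card ≤ _ at h1
    omega
  have hge : ∀ A ∈ S.erase B, (k + 1) * (k ^ 2 - 1) ≤ (U.filter fun u => P A u).card := by
    intro A hA
    obtain ⟨hAB, hA⟩ := mem_erase.1 hA
    refine (le_card_isotropic hstar ((hherm A hA).sub (hherm B hB)) (hS A hA B hB hAB)).trans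
      (card_le_card ?_)
    intro u
    simp [hU, hP]
  have hdc := sum_card_bipartiteAbove_eq_sum_card_bipartiteBelow (s := S.erase B) (t := U) P
  have h1 := card_nsmul_le_sum _ _ _ hge
  have h2 := sum_le_sum hle
  -- The bounds meet because `q⁴-1 = (q²+1)(q-1)(q+1)`.
  have heq : (S.erase B).card • ((k + 1) * (k ^ 2 - 1)) = ∑ u ∈ U, (k ^ 2 - 1) := by
    rw [sum_const, hUcard, card_erase_of_mem hB, hcard, smul_eq_mul, smul_eq_mul]
    obtain ⟨j, hj⟩ := Nat.exists_eq_add_of_le hk2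
    rw [hj, show (2 + j) ^ 4 - 1 = ((2 + j) ^ 2 + 1) * (j + 1) * (j + 3) by
      have : (2 + j) ^ 4 = ((2 + j) ^ 2 + 1) * (j + 1) * (j + 3) + 1 := by ring
      omega, Nat.add_sub_cancel, show 2 + j - 1 = j + 1 by omega]
    ring
  have hsum : ∑ u ∈ U, ((S.erase B).filter fun A => P A u).card = ∑ u ∈ U, (k ^ 2 - 1) :=
    le_antisymm h2 (by rw [← heq]; exact h1.trans hdc.le)
  have := (sum_eq_sum_iff_of_le hle).1 hsum u (by simpa [hU] using hu)
  have hkpos : 0 < k ^ 2 := by positivity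
  change (S.filter fun A => P A u).card = _
  rw [herase, this]
  omega

theorem card_ne_of_pairwise_det_sub_ne_zero (hstar : ∃ x : F, star x ≠ x)
    {S : Finset (Matrix (Fin 2) (Fin 2) F)} (hherm : ∀ A ∈ S, A.IsHermitian)
    (hS : ∀ A ∈ S, ∀ B ∈ S, A ≠ B → (A - B).det ≠ 0) :
    S.card ≠ ((fixedElems F).card ^ 2 + 1) * ((fixedElems F).card - 1) + 1 := by
  intro hcard
  have hk2 : 2 ≤ (fixedElems F).card := two_le_card_fixedElems
  have hfib : ∀ a ∈ S.image (fun A => A 0 0),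
      (S.filter fun A => A 0 0 = a).card = (fixedElems F).card ^ 2 := by
    intro a ha
    obtain ⟨B, hB, rfl⟩ := mem_image.1 ha
    have hu : (![1, 0] : Fin 2 → F) ≠ 0 := fun e => by simpa using congrFun e 0
    rw [← card_isotropic_difference_eq hstar hherm hS hcard hB hu]
    congr 1
    ext A
    rw [mem_filter, mem_filter, star_dotProduct_mulVec_fin_two]
    simp [sub_eq_zero]
  have h := card_eq_sum_card_image (fun A : Matrix (Fin 2) (Fin 2) F => A 0 0) S
  rw [sum_congr rfl hfib, sum_const, smul_eq_mul, hcard] at h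
  obtain ⟨j, hj⟩ := Nat.exists_eq_add_of_le hk2
  rw [hj] at h
  set m := (S.image fun A : Matrix (Fin 2) (Fin 2) F => A 0 0).card
  -- With `q = 2 + j`, cancelling `q` from `m q² = q³-q²+q` leaves `q(m+1) = q²+1`, so `q` divides
  -- 1.
  have h' : (2 + j) * (m + 1) * (2 + j) = (2 + j) * ((2 + j) * (2 + j) + 1) := by
    rw [show 2 + j - 1 = j + 1 by omega] at h
    linear_combination -h
  rw [mul_assoc] at h'
  have h'' := Nat.eq_of_mul_eq_mul_left (by omega) h'
  have hdvd : (2 + j) ∣ (2 + j) * (2 + j) + 1 := ⟨m + 1, by rw [← h'', mul_comm]⟩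
  have h1 : (2 + j) ∣ 1 := (Nat.dvd_add_right (dvd_mul_right _ _)).1 hdvd
  have := Nat.le_of_dvd one_pos h1
  omega

end HermitianForms

/-! ### Matrices of rank one -/

section Rank

theorem Matrix.rank_eq_one_of_det_eq_zero {F : Type*} [Field F] {A : Matrix (Fin 2) (Fin 2) F}
    (hdet : A.det = 0) (hA : A ≠ 0) : A.rank = 1 := by
  obtain ⟨u, hu, hAu⟩ := exists_mulVec_eq_zero_iff.2 hdet
  have h := LinearMap.finrank_range_add_finrank_ker A.mulVecLin
  have hker : Module.finrank F (LinearMap.ker A.mulVecLin) ≠ 0 := by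
    rw [Ne, Submodule.finrank_eq_zero, Submodule.eq_bot_iff]
    exact fun h => hu (h u (by simpa using hAu))
  have hrange : Module.finrank F (LinearMap.range A.mulVecLin) ≠ 0 := by
    rw [Ne, Submodule.finrank_eq_zero, LinearMap.range_eq_bot]
    intro h
    refine hA ?_
    ext i j
    have := congrFun (LinearMap.congr_fun h (Pi.single j 1)) i
    simpa using this
  rw [Module.finrank_fin_fun] at h
  unfold Matrix.rank
  omega

/-- The `2 × 2` minors of a matrix of rank at most one vanish. -/
theorem Matrix.mul_apply_comm_of_rank_le_one {F m n : Type*} [Field F] [Fintype n] [Finite m]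
    {A : Matrix m n F}
    (hA : A.rank ≤ 1) (i j : m) (k l : n) : A i k * A j l = A i l * A j k := by
  classical
  obtain ⟨⟨x, _⟩, hx⟩ := (finrank_le_one_iff (V := LinearMap.range A.mulVecLin)).1 hA
  have hcol : ∀ k, ∃ c : F, ∀ i, c * x i = A i k := by
    intro k
    obtain ⟨c, hc⟩ := hx ⟨A.mulVecLin (Pi.single k 1), LinearMap.mem_range_self _ _⟩
    refine ⟨c, fun i => ?_⟩
    have := congrFun (congrArg Subtype.val hc) i
    simpa using this
  obtain ⟨c, hc⟩ := hcol k
  obtain ⟨d, hd⟩ := hcol l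
  rw [← hc, ← hc, ← hd, ← hd]
  ring

theorem Matrix.rank_fromBlocks_zero {F m n : Type*} [Field F] [Fintype m] [Fintype n]
    [DecidableEq m] (A : Matrix m m F) :
    (fromBlocks A 0 0 (0 : Matrix n n F)).rank = A.rank := by
  refine le_antisymm ?_ ?_
  · have : fromBlocks A 0 0 (0 : Matrix n n F) =
        (fromRows 1 0 : Matrix (m ⊕ n) m F) * (A * (fromCols 1 0 : Matrix m (m ⊕ n) F)) := by
      rw [mul_fromCols, fromRows_mul]
      ext (i | i) (j | j) <;> simp
    rw [this]
    exact (rank_mul_le_right _ _).trans (rank_mul_le_left _ _)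
  · have : A = (fromCols 1 0 : Matrix m (m ⊕ n) F) *
        (fromBlocks A 0 0 (0 : Matrix n n F) * (fromRows 1 0 : Matrix (m ⊕ n) m F)) := by
      ext i j
      simp [mul_apply, one_apply]
    conv_lhs => rw [this]
    exact (rank_mul_le_right _ _).trans (rank_mul_le_left _ _)

end Rank

/-! ### Vertices, colourings and cliques of the graph -/

section HGL

/-- Adding an identity block embeds `HGL 2` into `HGL (2 + m)`. -/
def HGL.addBlock (m : ℕ) (F : Type*) [Field F] [StarRing F] : HGL 2 F →g HGL (2 + m) F where
  toFun A := ⟨(fromBlocks A.1 0 0 1).submatrix finSumFinEquiv.symm finSumFinEquiv.symm,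
    (IsHermitian.fromBlocks A.2.1 (by simp) isHermitian_one).submatrix _,
    (isUnit_submatrix_equiv _ _).2 (isUnit_fromBlocks_zero₂₁.2 ⟨A.2.2, isUnit_one⟩)⟩
  map_rel' {A B} h := by
    change ((fromBlocks A.1 0 0 1 - fromBlocks B.1 0 0 1).submatrix
      finSumFinEquiv.symm finSumFinEquiv.symm).rank = 1
    rw [rank_submatrix, sub_eq_add_neg, fromBlocks_neg, fromBlocks_add]
    have h' : (A.1 - B.1).rank = 1 := h
    simpa [rank_fromBlocks_zero, ← sub_eq_add_neg] using h'

variable {F : Type*} [Field F] [Fintype F] [DecidableEq F] [StarRing F]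

theorem le_card_invertible_hermitian (hstar : ∃ x : F, star x ≠ x) :
    (fixedElems F).card * (((fixedElems F).card ^ 2 + 1) * ((fixedElems F).card - 1)) ≤
      Nat.card {A : Matrix (Fin 2) (Fin 2) F // A.IsHermitian ∧ IsUnit A} := by
  classical
  set K := fixedElems F with hK
  -- Triples `(a, b, c)` with nonzero determinant: `a = 0` forces `b ≠ 0` and leaves `c` free; if `a
  -- ≠ 0`, each `b` excludes a single `c`.
  let T : Finset (Σ _ : F × F, F) := (K ×ˢ univ).sigma
    fun p => K.filter fun c => p.1 * c ≠ p.2 * star p.2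
  have hnorm : ∀ b : F, b * star b ∈ K := fun b => by simp [hK, mem_fixedElems, mul_comm]
  have hT : T.card = K.card * ((K.card ^ 2 + 1) * (K.card - 1)) := by
    rw [card_sigma, sum_product, ← add_sum_erase K _ (zero_mem_fixedElems (F := F))]
    have h0 : ∑ b : F, (K.filter fun c => (0 : F) * c ≠ b * star b).card =
        (K.card ^ 2 - 1) * K.card := by
      rw [← add_sum_erase univ _ (mem_univ (0 : F))]
      have : ∀ b ∈ (univ : Finset F).erase 0,
          (K.filter fun c => (0 : F) * c ≠ b * star b).card = K.card := by
        intro b hb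
        congr 1
        refine filter_true_of_mem fun c _ => ?_
        have hb0 : b ≠ 0 := (mem_erase.1 hb).1
        rw [zero_mul]
        exact (mul_ne_zero hb0 (star_ne_zero.2 hb0)).symm
      rw [sum_congr rfl this, sum_const, card_erase_of_mem (mem_univ _), card_univ,
        card_fixedElems_sq hstar]
      simp [hK]
    have h1 : ∀ a ∈ K.erase 0,
        ∑ b : F, (K.filter fun c => a * c ≠ b * star b).card = K.card ^ 2 * (K.card - 1) := by
      intro a ha
      obtain ⟨ha0, haK⟩ := mem_erase.1 ha
      have : ∀ b ∈ (univ : Finset F),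
          (K.filter fun c => a * c ≠ b * star b).card = K.card - 1 := by
        intro b _
        have hmem : b * star b / a ∈ K := by
          have h2 := hnorm b
          rw [hK, mem_fixedElems] at haK h2 ⊢
          rw [star_div₀, h2, haK]
        rw [← card_erase_of_mem hmem]
        congr 1
        ext c
        rw [mem_filter, mem_erase, and_comm, Ne, Ne, eq_div_iff ha0, mul_comm c]
      rw [sum_congr rfl this, sum_const, card_univ, card_fixedElems_sq hstar, smul_eq_mul]
    rw [h0, sum_congr rfl h1, sum_const, hK, card_fixedElems_erase, smul_eq_mul]
    obtain ⟨k, hk⟩ := Nat.exists_eq_add_of_le (two_le_card_fixedElems (F := F))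
    rw [hk, show (2 + k) ^ 2 - 1 = (k + 1) * (k + 3) by
      have : (2 + k) ^ 2 = (k + 1) * (k + 3) + 1 := by ring
      omega, show 2 + k - 1 = k + 1 by omega]
    ring
  rw [← hT, ← Fintype.card_coe, ← Nat.card_eq_fintype_card]
  refine Nat.card_le_card_of_injective
    (fun p : T => ⟨!![p.1.1.1, p.1.1.2; star p.1.1.2, p.1.2], ?_, ?_⟩) ?_
  · obtain ⟨⟨⟨a, b⟩, c⟩, h⟩ := p
    simp only [T, mem_sigma, mem_product, mem_filter, hK, mem_fixedElems] at h
    ext i j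
    fin_cases i <;> fin_cases j <;> simp [h.1.1, h.2.1]
  · obtain ⟨⟨⟨a, b⟩, c⟩, h⟩ := p
    simp only [T, mem_sigma, mem_filter] at h
    rw [isUnit_iff_isUnit_det, det_fin_two_of]
    exact (sub_ne_zero.2 h.2.2).isUnit
  · rintro ⟨⟨⟨a, b⟩, c⟩, h⟩ ⟨⟨⟨a', b'⟩, c'⟩, h'⟩ e
    have e' := congrArg Subtype.val e
    have e00 : a = a' := congrFun (congrFun e' 0) 0
    have e01 : b = b' := congrFun (congrFun e' 0) 1
    have e11 : c = c' := congrFun (congrFun e' 1) 1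
    subst e00 e01 e11
    rfl

theorem not_colorable_HGL_two (hstar : ∃ x : F, star x ≠ x) :
    ¬ (HGL 2 F).Colorable (fixedElems F).card := by
  classical
  rintro ⟨C⟩
  have hk2 := two_le_card_fixedElems (F := F)
  have : Nonempty (Fin (fixedElems F).card) := ⟨⟨0, by omega⟩⟩
  have hle := le_card_invertible_hermitian hstar
  rw [Nat.card_eq_fintype_card] at hle
  obtain ⟨c, hc⟩ := Fintype.exists_le_card_fiber_of_mul_le_card (f := C)
    (by simpa using hle)
  obtain ⟨I, hI, hIcard⟩ := exists_subset_card_eq hc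
  have hI0 : (0 : Matrix (Fin 2) (Fin 2) F) ∉ I.map (Function.Embedding.subtype _) := by
    intro h
    obtain ⟨A, -, hA⟩ := mem_map.1 h
    refine not_isUnit_zero (M₀ := Matrix (Fin 2) (Fin 2) F) ?_
    rw [← hA]
    exact A.2.2
  have hdet : ∀ A ∈ I, A.1.det ≠ 0 := fun A _ =>
    ((isUnit_iff_isUnit_det _).1 A.2.2).ne_zero
  refine card_ne_of_pairwise_det_sub_ne_zero hstar
    (S := insert 0 (I.map (Function.Embedding.subtype _))) ?_ ?_ ?_
  · intro A hA
    rcases mem_insert.1 hA with rfl | hA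
    · exact isHermitian_zero
    · obtain ⟨A, -, rfl⟩ := mem_map.1 hA
      exact A.2.1
  · intro A hA B hB hAB
    rcases mem_insert.1 hA with rfl | hA <;> rcases mem_insert.1 hB with rfl | hB
    · exact absurd rfl hAB
    · obtain ⟨B, hBI, rfl⟩ := mem_map.1 hB
      simpa [det_neg] using hdet B hBI
    · obtain ⟨A, hAI, rfl⟩ := mem_map.1 hA
      simpa using hdet A hAI
    · obtain ⟨A, hAI, rfl⟩ := mem_map.1 hA
      obtain ⟨B, hBI, rfl⟩ := mem_map.1 hB
      intro h
      have hadj : (HGL 2 F).Adj A B := rank_eq_one_of_det_eq_zero h (sub_ne_zero.2 hAB)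
      exact C.valid hadj ((mem_filter.1 (hI hAI)).2.trans (mem_filter.1 (hI hBI)).2.symm)
  · rw [card_insert_of_notMem hI0, card_map, hIcard]

/-- Some diagonal entry, which lies in the fixed field, separates the clique. Equal entries `X i i =
Y i i` make row `i` of `X - Y` vanish, by the 2 × 2 minors; a third member `Z` with `Z i i ≠ X i i`
then recovers all other entries from row and column `i`. -/
theorem card_clique_HGL_le {n : ℕ}
    {T : Finset {A : Matrix (Fin n) (Fin n) F // A.IsHermitian ∧ IsUnit A}}
    (hT : (HGL n F).IsClique T) : T.card ≤ (fixedElems F).card := by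
  classical
  rcases T.eq_empty_or_nonempty with rfl | ⟨A, hA⟩
  · simp
  by_cases hAB : ∃ B ∈ T, B ≠ A
  swap
  · push Not at hAB
    have h1 : T.card ≤ 1 := card_le_one.2 fun a ha b hb => (hAB a ha).trans (hAB b hb).symm
    have := two_le_card_fixedElems (F := F)
    omega
  obtain ⟨B, hB, hne⟩ := hAB
  have hminor : ∀ X ∈ T, ∀ Y ∈ T, ∀ i j k l,
      (X.1 - Y.1) i k * (X.1 - Y.1) j l = (X.1 - Y.1) i l * (X.1 - Y.1) j k := by
    intro X hX Y hY
    refine mul_apply_comm_of_rank_le_one ?_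
    by_cases h : X = Y
    · simp [h]
    · exact (show (X.1 - Y.1).rank = 1 from hT hX hY h).le
  have hdiff : ∀ X Y : {A : Matrix (Fin n) (Fin n) F // A.IsHermitian ∧ IsUnit A}, ∀ i j,
      (X.1 - Y.1) j i = star ((X.1 - Y.1) i j) := fun X Y i j =>
    ((X.2.1.sub Y.2.1).apply j i).symm
  have hrow : ∀ X ∈ T, ∀ Y ∈ T, ∀ i, X.1 i i = Y.1 i i → ∀ j, (X.1 - Y.1) i j = 0 := by
    intro X hX Y hY i h j
    have h1 := hminor X hX Y hY i j i j
    rw [Matrix.sub_apply, h, sub_self, zero_mul, hdiff X Y i j] at h1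
    rcases mul_eq_zero.1 h1.symm with h2 | h2
    · exact h2
    · exact star_eq_zero.1 h2
  obtain ⟨i, hi⟩ : ∃ i, B.1 i i ≠ A.1 i i := by
    by_contra! h
    refine hne (Subtype.ext ?_)
    ext i j
    exact sub_eq_zero.1 (hrow B hB A hA i (h i) j)
  refine card_le_card_of_injOn (fun X => X.1 i i)
    (fun X _ => mem_coe.2 (mem_fixedElems.2 (X.2.1.apply i i))) ?_
  intro X hX Y hY hXY
  obtain ⟨Z, hZ, hZX⟩ : ∃ Z ∈ T, X.1 i i - Z.1 i i ≠ 0 := by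
    by_cases h : X.1 i i = A.1 i i
    · exact ⟨B, hB, by rw [h]; exact sub_ne_zero.2 hi.symm⟩
    · exact ⟨A, hA, sub_ne_zero.2 h⟩
  have hij : ∀ j, X.1 i j = Y.1 i j := fun j => sub_eq_zero.1 (hrow X hX Y hY i hXY j)
  have hji : ∀ j, X.1 j i = Y.1 j i := fun j => by
    rw [← X.2.1.apply, ← Y.2.1.apply, hij]
  refine Subtype.ext ?_
  ext j k
  have h1 := hminor X hX Z hZ i j i k
  have h2 := hminor Y hY Z hZ i j i k
  simp only [Matrix.sub_apply, ← hij, ← hji] at h1 h2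
  refine mul_left_cancel₀ hZX ?_
  linear_combination h1 - h2

end HGL

theorem mainTheorem2 {F : Type*} [Field F] [Finite F] [StarRing F]
    (hstar : ∃ x : F, star x ≠ x) (q : ℕ) (hq : Nat.card F = q ^ 2)
    (n : ℕ) (hn : 2 ≤ n) (H : (HGL n F).Subgraph) (hH : IsCoreOf H) :
    (q : ℕ∞) < H.coe.chromaticNumber ∧ H.coe ≠ ⊤ := by
  classical
  have := Fintype.ofFinite F
  obtain ⟨m, rfl⟩ := Nat.exists_eq_add_of_le hn
  obtain ⟨-, ⟨g⟩⟩ := hH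
  have hqK : q = (fixedElems F).card := by
    rw [Nat.card_eq_fintype_card, card_fixedElems_sq hstar] at hq
    exact (Nat.pow_left_injective two_ne_zero hq).symm
  have hχ : (q : ℕ∞) < H.coe.chromaticNumber := by
    rw [← not_le, SimpleGraph.chromaticNumber_le_iff_colorable, hqK]
    exact fun h => not_colorable_HGL_two hstar (h.of_hom (g.comp (HGL.addBlock m F)))
  refine ⟨hχ, fun htop => ?_⟩
  rw [htop, SimpleGraph.chromaticNumber_top, Nat.cast_lt, ← not_le, hqK] at hχ
  refine hχ ?_
  rw [← card_univ, ← card_map (Function.Embedding.subtype (· ∈ H.verts))]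
  refine card_clique_HGL_le fun X hX Y hY hXY => ?_
  obtain ⟨X, -, rfl⟩ := mem_map.1 (mem_coe.1 hX)
  obtain ⟨Y, -, rfl⟩ := mem_map.1 (mem_coe.1 hY)
  have : H.coe.Adj X Y := by
    rw [htop]
    exact fun h => hXY (by rw [h])
  exact H.adj_sub this
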